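/- Let $\mathcal H_A=\mathcal H_B=(\mathbb C^2)^{\otimes 2}$ (two qubits each), let $P_0=|00\rangle\langle 00|+|11\rangle\langle 11|$ and $P_1=I_4-P_0$, and for $\beta\in[0,1]$ let $\mathcal N_\beta$ be the two-qubit block-depolarizing channel $$\mathcal N_\beta(\rho)=(1-\beta)\operatorname{Tr}(P_0\rho)\frac{P_0}{2}+(1-\beta)\operatorname{Tr}(P_1\rho)\frac{P_1}{2}+\beta\operatorname{Tr}(\rho)\frac{I_4}{4}.$$ Consider the product mechanism $\mathcal E=\mathcal N_{1/2}\otimes\mathcal N_{1/2}$ on $\mathcal H_A\otimes\mathcal H_B$. For $s\in\mathbb R$ let $\mathbb H_s$ be the set of density operators $\rho$ on $\mathcal H_A\otimes\mathcal H_B$ of rank one (pure states) whose entanglement entropy $\mathbf E(\rho)=-\operatorname{Tr}(\rho_A\log\rho_A)$, $\rho_A=\operatorname{Tr}_B\rho$, is at least $s$ ($\log$ is the natural logarithm). Say that $\mathcal E$ is ECLM-$\varepsilon$-QLDP on $\mathbb H_s$ if for all finite sets $O_A,O_B$, all local POVMs $\{M_a\}_{a\in O_A}$ on $\mathcal H_A$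 and $\{M_b\}_{b\in O_B}$ on $\mathcal H_B$, all $\rho,\rho'\in\mathbb H_s$ and all $T\subseteq O_A\times O_B$, $$\sum_{(a,b)\in T}\operatorname{Tr}\big((M_a\otimes M_b)\mathcal E(\rho)\big)\le e^{\varepsilon}\sum_{(a,b)\in T}\operatorname{Tr}\big((M_a\otimes M_b)\mathcal E(\rho')\big).$$ Let $\varepsilon^*(s)\in[-\infty,+\infty]$ be the optimal leakage level, i.e. the infimum of all $\varepsilon\in\mathbb R$ for which $\mathcal E$ is ECLM-$\varepsilon$-QLDP on $\mathbb H_s$. Then: 1. If $s\le\log 2$, then $\varepsilon^*(s)\le 2\log 3$. 2. If $\log 2<s\le\log 4$, then there is exactly one $\tau=\tau(s)\in[1/2,1]$ with $$s=\log 2-\tau\log\tau-(1-\tau)\log(1-\tau)$$ (with $0\log 0=0$), and $$\varepsilon^*(s)\le\log\frac{8\tau(s)+1}{3-2\tau(s)}.$$ Moreover, $s\mapsto\tau(s)$ is strictly decreasing on $(\log 2,\log 4]$. -/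

import Mathlib

open scoped Kronecker ComplexOrder

namespace QLDP

/-- The partial trace over the second factor of a bipartite operator, `ρ ↦ Tr_B ρ`. -/
def partialTraceB {m n : Type*} [Fintype n] (ρ : Matrix (m × n) (m × n) ℂ) : Matrix m m ℂ :=
  Matrix.of fun i j => ∑ k, ρ (i, k) (j, k)

open Classical in
/-- The von Neumann entropy `S(ρ) = -∑ λⱼ log λⱼ` (natural logarithm, `0 log 0 = 0`), where the
`λⱼ` are the eigenvalues of the Hermitian matrix `ρ`; only used for density matrices. -/
noncomputable def vonNeumannEntropy {m : Type*} [Fintype m] (ρ : Matrix m m ℂ) : ℝ :=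
  if h : ρ.IsHermitian then ∑ j, Real.negMulLog (h.eigenvalues j) else 0

/-- Density operators: positive semidefinite matrices of unit trace. -/
def IsDensity {m : Type*} [Fintype m] (ρ : Matrix m m ℂ) : Prop :=
  ρ.PosSemidef ∧ ρ.trace = 1

/-- The entanglement entropy of a bipartite pure state: the entropy of its reduced state on `A`. -/
noncomputable def entanglementEntropy {m n : Type*} [Fintype m] [Fintype n]
    (ρ : Matrix (m × n) (m × n) ℂ) : ℝ :=
  vonNeumannEntropy (partialTraceB ρ)

/-- The domain `ℍ_s`: the pure states of the bipartite system (density operators of rank one)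
whose entanglement entropy is at least `s`. -/
def entangledDomain (m n : Type*) [Fintype m] [Fintype n] (s : ℝ) :
    Set (Matrix (m × n) (m × n) ℂ) :=
  {ρ | IsDensity ρ ∧ ρ.rank = 1 ∧ s ≤ entanglementEntropy ρ}

/-- A positive operator-valued measurement with finite outcome set `O`. -/
structure POVM (O m : Type*) [Fintype O] [Fintype m] [DecidableEq m] where
  /-- The operator of each outcome. -/
  op : O → Matrix m m ℂ
  posSemidef : ∀ k, (op k).PosSemidef
  sum_eq_one : ∑ k, op k = 1

/-- `Pr[M(σ) ∈ T]` for the local measurement `M = {M_a ⊗ M_b}` performed on the state `σ`. -/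
noncomputable def localProb {OA OB m n : Type*} [Fintype OA] [Fintype OB] [Fintype m] [Fintype n]
    [DecidableEq m] [DecidableEq n] (MA : POVM OA m) (MB : POVM OB n)
    (σ : Matrix (m × n) (m × n) ℂ) (T : Finset (OA × OB)) : ℝ :=
  ∑ k ∈ T, (Matrix.trace ((MA.op k.1 ⊗ₖ MB.op k.2) * σ)).re

/-- The product mechanism `E_A ⊗ E_B` as a linear map on bipartite operators. -/
noncomputable def productMechanism {m n : Type*} [Fintype m] [Fintype n]
    [DecidableEq m] [DecidableEq n]
    (EA : Matrix m m ℂ →ₗ[ℂ] Matrix m m ℂ) (EB : Matrix n n ℂ →ₗ[ℂ] Matrix n n ℂ) :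
    Matrix (m × n) (m × n) ℂ →ₗ[ℂ] Matrix (m × n) (m × n) ℂ :=
  (kroneckerLinearEquiv m m n n ℂ).toLinearMap ∘ₗ TensorProduct.map EA EB ∘ₗ
    (kroneckerLinearEquiv m m n n ℂ).symm.toLinearMap

/-- `productMechanism EA EB` is the linear map with `X ⊗ Y ↦ E_A(X) ⊗ E_B(Y)`. -/
theorem productMechanism_kronecker {m n : Type*} [Fintype m] [Fintype n]
    [DecidableEq m] [DecidableEq n]
    (EA : Matrix m m ℂ →ₗ[ℂ] Matrix m m ℂ) (EB : Matrix n n ℂ →ₗ[ℂ] Matrix n n ℂ)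
    (X : Matrix m m ℂ) (Y : Matrix n n ℂ) :
    productMechanism EA EB (X ⊗ₖ Y) = EA X ⊗ₖ EB Y := by
  rw [← kroneckerLinearEquiv_tmul (R := ℂ) X Y]
  simp [productMechanism]

/-- `E` is entanglement-constrained `ε`-quantum locally differentially private against local
measurement adversaries on the domain `ℍ_s`. -/
def IsECLMQLDP {m n : Type*} [Fintype m] [Fintype n] [DecidableEq m] [DecidableEq n]
    (E : Matrix (m × n) (m × n) ℂ →ₗ[ℂ] Matrix (m × n) (m × n) ℂ) (s ε : ℝ) : Prop :=
  ∀ (OA OB : Type) [Fintype OA] [Fintype OB] (MA : POVM OA m) (MB : POVM OB n),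
    ∀ ρ ∈ entangledDomain m n s, ∀ ρ' ∈ entangledDomain m n s, ∀ T : Finset (OA × OB),
      localProb MA MB (E ρ) T ≤ Real.exp ε * localProb MA MB (E ρ') T

/-- The optimal leakage level `ε*(s)`: the infimum of all `ε` for which `E` is private, in the
extended reals, so that it is `+∞` if `E` is private for no `ε`. -/
noncomputable def optimalLeakage {m n : Type*} [Fintype m] [Fintype n] [DecidableEq m]
    [DecidableEq n] (E : Matrix (m × n) (m × n) ℂ →ₗ[ℂ] Matrix (m × n) (m × n) ℂ) (s : ℝ) :
    EReal :=
  sInf ((fun ε : ℝ => (ε : EReal)) '' {ε : ℝ | IsECLMQLDP E s ε})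

/-- The index set of the computational basis `|00⟩, |01⟩, |10⟩, |11⟩` of two qubits. -/
abbrev TwoQubit : Type := Fin 2 × Fin 2

/-- The even projector `P₀ = |00⟩⟨00| + |11⟩⟨11|`. -/
noncomputable def evenProj : Matrix TwoQubit TwoQubit ℂ :=
  Matrix.single (0, 0) (0, 0) 1 + Matrix.single (1, 1) (1, 1) 1

/-- The odd projector `P₁ = I₄ - P₀`. -/
noncomputable def oddProj : Matrix TwoQubit TwoQubit ℂ := 1 - evenProj

/-- The two-qubit block-depolarizing channel
`N_β(ρ) = (1-β) Tr(P₀ρ) P₀/2 + (1-β) Tr(P₁ρ) P₁/2 + β Tr(ρ) I₄/4`; the factor `Tr(ρ)`, which is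
`1` on density operators, makes it linear on all operators. -/
noncomputable def blockDepolarizing (β : ℝ) :
    Matrix TwoQubit TwoQubit ℂ →ₗ[ℂ] Matrix TwoQubit TwoQubit ℂ where
  toFun ρ :=
    ((1 - β : ℂ) * (evenProj * ρ).trace / 2) • evenProj
      + ((1 - β : ℂ) * (oddProj * ρ).trace / 2) • oddProj
      + ((β : ℂ) * ρ.trace / 4) • (1 : Matrix TwoQubit TwoQubit ℂ)
  map_add' X Y := by
    simp only [Matrix.mul_add, Matrix.trace_add]
    module
  map_smul' c X := by
    simp only [Matrix.mul_smul, Matrix.trace_smul, smul_eq_mul, RingHom.id_apply]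
    module

end QLDP

/-! Each `N_β` is a classical channel reading only the parity of its input. Hence the output of the
product mechanism is diagonal, with entries that are affine in the joint distribution of the two
local parities, and a Loewner bound `b ≤ E ρ ≤ a` over all inputs yields the leakage `log (a / b)`
because local measurement probabilities are monotone. A joint probability is at most each of its
marginals, so it suffices to bound the marginals, that is, the parity distributions of the reduced
states. Dephasing in the computational basis does not decrease the entropy, and a parity class has
two elements, so `S(σ) ≤ log 2 + h(r)` when `σ` has even parity with probability `r`. Large
entanglement entropy therefore forces `r` close to `1/2`, for both reduced states at once, since
those of a pure state have equal entropy. -/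

namespace QLDP

open Matrix Real
open scoped MatrixOrder

section Entropy

theorem sum_map_le_sum_map_mulVec {ι : Type*} [Fintype ι] [DecidableEq ι] {S : Matrix ι ι ℝ}
    (hS : S ∈ doublyStochastic ℝ ι) {s : Set ℝ} {f : ℝ → ℝ} (hf : ConcaveOn ℝ s f)
    {x : ι → ℝ} (hx : ∀ j, x j ∈ s) : ∑ j, f (x j) ≤ ∑ i, f ((S *ᵥ x) i) := by
  calc ∑ j, f (x j) = ∑ j, ∑ i, S i j * f (x j) := by
        simp only [← Finset.sum_mul, sum_col_of_mem_doublyStochastic hS, one_mul]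
    _ = ∑ i, ∑ j, S i j * f (x j) := Finset.sum_comm
    _ ≤ ∑ i, f ((S *ᵥ x) i) := Finset.sum_le_sum fun i _ =>
        hf.le_map_sum (fun j _ => nonneg_of_mem_doublyStochastic hS)
          (sum_row_of_mem_doublyStochastic hS i) fun j _ => hx j

theorem map_norm_sq_mem_doublyStochastic {𝕜 ι : Type*} [RCLike 𝕜] [Fintype ι] [DecidableEq ι]
    {U : Matrix ι ι 𝕜} (hU : U ∈ unitaryGroup ι 𝕜) :
    U.map (fun z => ‖z‖ ^ 2) ∈ doublyStochastic ℝ ι := by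
  have row_sum {V : Matrix ι ι 𝕜} (hV : V ∈ unitaryGroup ι 𝕜) (i : ι) : ∑ j, ‖V i j‖ ^ 2 = 1 := by
    have h := congrFun₂ (mem_unitaryGroup_iff.1 hV) i i
    simp only [mul_apply, star_apply, RCLike.star_def, RCLike.mul_conj, one_apply_eq] at h
    exact_mod_cast h
  refine mem_doublyStochastic_iff_sum.2 ⟨fun _ _ => sq_nonneg _, row_sum hU, fun j => ?_⟩
  simpa [star_apply] using row_sum (Unitary.star_mem hU) j

theorem re_diag_eq_map_norm_sq_mulVec_eigenvalues {𝕜 ι : Type*} [RCLike 𝕜] [Fintype ι]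
    [DecidableEq ι] {A : Matrix ι ι 𝕜} (hA : A.IsHermitian) (i : ι) :
    RCLike.re (A i i) =
      (((hA.eigenvectorUnitary : Matrix ι ι 𝕜).map fun z => ‖z‖ ^ 2) *ᵥ hA.eigenvalues) i := by
  have h := congrFun₂ hA.spectral_theorem i i
  rw [Unitary.conjStarAlgAut_apply, mul_apply] at h
  rw [h, map_sum]
  refine Finset.sum_congr rfl fun j _ => ?_
  rw [mul_diagonal, star_apply, RCLike.star_def, mul_right_comm, RCLike.mul_conj,
    Function.comp_apply]
  norm_cast

/-- The Peierls inequality. -/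
theorem sum_map_eigenvalues_le_sum_map_re_diag {𝕜 ι : Type*} [RCLike 𝕜] [Fintype ι]
    [DecidableEq ι] {A : Matrix ι ι 𝕜} (hA : A.IsHermitian) {s : Set ℝ} {f : ℝ → ℝ}
    (hf : ConcaveOn ℝ s f) (hs : ∀ j, hA.eigenvalues j ∈ s) :
    ∑ j, f (hA.eigenvalues j) ≤ ∑ i, f (RCLike.re (A i i)) := by
  simp only [re_diag_eq_map_norm_sq_mulVec_eigenvalues hA]
  exact sum_map_le_sum_map_mulVec
    (map_norm_sq_mem_doublyStochastic hA.eigenvectorUnitary.2) hf hs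

theorem sum_negMulLog_le {ι : Type*} (s : Finset ι) {p : ι → ℝ} (hp : ∀ i ∈ s, 0 ≤ p i) :
    ∑ i ∈ s, negMulLog (p i) ≤ negMulLog (∑ i ∈ s, p i) + (∑ i ∈ s, p i) * log s.card := by
  rcases s.eq_empty_or_nonempty with rfl | hs
  · simp
  have hcard : (0 : ℝ) < s.card := by exact_mod_cast hs.card_pos
  have jensen := concaveOn_negMulLog.le_map_sum (t := s) (w := fun _ => (s.card : ℝ)⁻¹) (p := p)
    (fun _ _ => (inv_pos.2 hcard).le) (by simp [hcard.ne']) hp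
  simp only [smul_eq_mul, ← Finset.mul_sum, negMulLog_mul] at jensen
  rw [negMulLog, log_inv] at jensen
  have h := mul_le_mul_of_nonneg_left jensen hcard.le
  field_simp at h
  linarith

theorem sum_negMulLog_le_log_add_sum_fiber {ι κ : Type*} [Fintype ι] [Fintype κ] [DecidableEq κ]
    (f : ι → κ) {d : ℕ} (hd : ∀ k, Finset.card {i | f i = k} ≤ d) {p : ι → ℝ}
    (hp : p ∈ stdSimplex ℝ ι) :
    ∑ i, negMulLog (p i) ≤ log d + ∑ k, negMulLog (∑ i with f i = k, p i) := by
  have hfiber (k : κ) : ∑ i with f i = k, negMulLog (p i) ≤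
      (∑ i with f i = k, p i) * log d + negMulLog (∑ i with f i = k, p i) := by
    have hlog : log (Finset.card {i | f i = k}) ≤ log d := by
      rcases Nat.eq_zero_or_pos (Finset.card {i | f i = k}) with h | h
      · simp [h, log_natCast_nonneg]
      · gcongr
        exact hd k
    have hnonneg : 0 ≤ ∑ i with f i = k, p i := Finset.sum_nonneg fun i _ => hp.1 i
    linarith [sum_negMulLog_le {i | f i = k} fun i _ => hp.1 i,
      mul_le_mul_of_nonneg_left hlog hnonneg]
  calc ∑ i, negMulLog (p i) = ∑ k, ∑ i with f i = k, negMulLog (p i) :=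
        (Finset.sum_fiberwise _ _ _).symm
    _ ≤ _ := Finset.sum_le_sum fun k _ => hfiber k
    _ = _ := by
        rw [Finset.sum_add_distrib, ← Finset.sum_mul, Finset.sum_fiberwise, hp.2, one_mul]

variable {m : Type*} [Fintype m]

theorem vonNeumannEntropy_eq_sum_eigenvalues [DecidableEq m] {A : Matrix m m ℂ}
    (hA : A.IsHermitian) : vonNeumannEntropy A = ∑ j, negMulLog (hA.eigenvalues j) := by
  rw [vonNeumannEntropy, dif_pos hA]
  congr!

theorem vonNeumannEntropy_eq_sum_roots_charpoly [DecidableEq m] {A : Matrix m m ℂ}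
    (hA : A.IsHermitian) :
    vonNeumannEntropy A = (A.charpoly.roots.map fun z => negMulLog z.re).sum := by
  rw [vonNeumannEntropy_eq_sum_eigenvalues hA, hA.roots_charpoly_eq_eigenvalues, Multiset.map_map]
  rfl

theorem vonNeumannEntropy_le_sum_negMulLog_diag {A : Matrix m m ℂ} (hA : A.PosSemidef) :
    vonNeumannEntropy A ≤ ∑ i, negMulLog (A i i).re := by
  classical
  rw [vonNeumannEntropy_eq_sum_eigenvalues hA.isHermitian]
  exact sum_map_eigenvalues_le_sum_map_re_diag hA.isHermitian concaveOn_negMulLog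
    hA.eigenvalues_nonneg

theorem IsDensity.re_diag_mem_stdSimplex {A : Matrix m m ℂ} (hA : IsDensity A) :
    (fun i => (A i i).re) ∈ stdSimplex ℝ m := by
  refine ⟨fun i => (Complex.le_def.1 hA.1.diag_nonneg).1, ?_⟩
  simpa [trace] using congrArg Complex.re hA.2

/-- The two spectra differ only by zeros, which do not contribute to the entropy. -/
theorem vonNeumannEntropy_conjTranspose_mul_self {n : Type*} [Fintype n] (X : Matrix m n ℂ) :
    vonNeumannEntropy (Xᴴ * X) = vonNeumannEntropy (X * Xᴴ) := by
  classical
  rw [vonNeumannEntropy_eq_sum_roots_charpoly (isHermitian_conjTranspose_mul_self X),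
    vonNeumannEntropy_eq_sum_roots_charpoly (isHermitian_mul_conjTranspose_self X)]
  have h := congrArg (fun p => (p.roots.map fun z : ℂ => negMulLog z.re).sum)
    (charpoly_mul_comm' X Xᴴ)
  simpa [Polynomial.roots_mul, (charpoly_monic _).ne_zero, Polynomial.X_ne_zero,
    Multiset.map_nsmul, Multiset.sum_nsmul] using h.symm

theorem vonNeumannEntropy_transpose {A : Matrix m m ℂ} (hA : A.IsHermitian) :
    vonNeumannEntropy Aᵀ = vonNeumannEntropy A := by
  classical
  rw [vonNeumannEntropy_eq_sum_roots_charpoly hA.transpose,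
    vonNeumannEntropy_eq_sum_roots_charpoly hA, charpoly_transpose]

end Entropy

section PartialTrace

variable {m n : Type*} [Fintype m] [Fintype n]

/-- The partial trace over the first factor of a bipartite operator, `ρ ↦ Tr_A ρ`, obtained from
`partialTraceB` by exchanging the two factors. -/
def partialTraceA (ρ : Matrix (m × n) (m × n) ℂ) : Matrix n n ℂ :=
  partialTraceB (ρ.submatrix Prod.swap Prod.swap)

theorem IsDensity.partialTraceB {ρ : Matrix (m × n) (m × n) ℂ} (hρ : IsDensity ρ) :
    IsDensity (partialTraceB ρ) := by
  constructor
  · have hsum : QLDP.partialTraceB ρ = ∑ k, ρ.submatrix (·, k) (·, k) := by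
      ext i j
      simp [QLDP.partialTraceB, Matrix.sum_apply]
    rw [hsum]
    exact posSemidef_sum _ fun k _ => hρ.1.submatrix _
  · simpa [QLDP.partialTraceB, trace, Fintype.sum_prod_type] using hρ.2

theorem IsDensity.partialTraceA {ρ : Matrix (m × n) (m × n) ℂ} (hρ : IsDensity ρ) :
    IsDensity (partialTraceA ρ) := by
  refine IsDensity.partialTraceB ⟨hρ.1.submatrix _, ?_⟩
  rw [← hρ.2]
  exact (Equiv.prodComm n m).sum_comp fun z => ρ z z

theorem exists_eq_vecMulVec_star_of_rank_eq_one {𝕜 : Type*} [RCLike 𝕜] {A : Matrix m m 𝕜}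
    (hA : A.PosSemidef) (hr : A.rank = 1) : ∃ v : m → 𝕜, A = vecMulVec v (star v) := by
  classical
  have hH := hA.isHermitian
  rw [hH.rank_eq_card_non_zero_eigs, Fintype.card_eq_one_iff] at hr
  obtain ⟨⟨k, _⟩, hk⟩ := hr
  have heig (j : m) (hj : j ≠ k) : hH.eigenvalues j = 0 := by
    by_contra hne
    exact hj (congrArg Subtype.val (hk ⟨j, hne⟩))
  have hsqrt : (hH.eigenvalues k : 𝕜) = (√(hH.eigenvalues k) : 𝕜) * (√(hH.eigenvalues k) : 𝕜) := by
    rw [← RCLike.ofReal_mul, Real.mul_self_sqrt (hA.eigenvalues_nonneg k)]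
  refine ⟨fun i => (√(hH.eigenvalues k) : 𝕜) * (hH.eigenvectorUnitary : Matrix m m 𝕜) i k, ?_⟩
  ext i j
  have h := congrFun₂ hH.spectral_theorem i j
  rw [Unitary.conjStarAlgAut_apply, mul_apply, Finset.sum_eq_single k] at h
  · rw [h, mul_diagonal, star_apply, Function.comp_apply, hsqrt, vecMulVec_apply, Pi.star_apply,
      star_mul', RCLike.star_def, RCLike.conj_ofReal]
    ring
  · intro l _ hl
    simp [mul_diagonal, heig l hl]
  · simp

theorem vonNeumannEntropy_partialTraceA_of_rank_eq_one {ρ : Matrix (m × n) (m × n) ℂ}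
    (hρ : ρ.PosSemidef) (hr : ρ.rank = 1) :
    vonNeumannEntropy (partialTraceA ρ) = vonNeumannEntropy (partialTraceB ρ) := by
  obtain ⟨v, rfl⟩ := exists_eq_vecMulVec_star_of_rank_eq_one hρ hr
  set X : Matrix m n ℂ := of fun i k => v (i, k) with hX
  have hB : partialTraceB (vecMulVec v (star v)) = X * Xᴴ := by
    ext i j
    simp [partialTraceB, vecMulVec_apply, mul_apply, hX]
  have hA : partialTraceA (vecMulVec v (star v)) = (Xᴴ * X)ᵀ := by
    ext i j
    simp [partialTraceA, partialTraceB, vecMulVec_apply, mul_apply, hX, mul_comm]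
  rw [hA, hB, vonNeumannEntropy_transpose (isHermitian_conjTranspose_mul_self X),
    vonNeumannEntropy_conjTranspose_mul_self]

end PartialTrace

section LocalMeasurement

theorem trace_mul_nonneg {𝕜 m : Type*} [RCLike 𝕜] [Fintype m] {A B : Matrix m m 𝕜}
    (hA : A.PosSemidef) (hB : B.PosSemidef) : 0 ≤ (A * B).trace := by
  classical
  obtain ⟨C, rfl⟩ := CStarAlgebra.nonneg_iff_eq_star_mul_self.1 hA.nonneg
  rw [star_eq_conjTranspose, Matrix.mul_assoc, trace_mul_comm]
  exact (hB.mul_mul_conjTranspose_same C).trace_nonneg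

variable {OA OB m n : Type*} [Fintype OA] [Fintype OB] [Fintype m] [Fintype n]
  [DecidableEq m] [DecidableEq n]

theorem localProb_mono (MA : POVM OA m) (MB : POVM OB n) (T : Finset (OA × OB)) :
    Monotone fun σ => localProb MA MB σ T := by
  intro σ σ' h
  refine Finset.sum_le_sum fun k _ => sub_nonneg.1 ?_
  rw [← Complex.sub_re, ← trace_sub, ← mul_sub]
  exact (Complex.le_def.1
    (trace_mul_nonneg ((MA.posSemidef k.1).kronecker (MB.posSemidef k.2)) (le_iff.1 h))).1

theorem localProb_smul (MA : POVM OA m) (MB : POVM OB n) (c : ℝ) (σ : Matrix (m × n) (m × n) ℂ)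
    (T : Finset (OA × OB)) : localProb MA MB (c • σ) T = c * localProb MA MB σ T := by
  simp [localProb, Finset.mul_sum]

theorem optimalLeakage_le_log_div
    {E : Matrix (m × n) (m × n) ℂ →ₗ[ℂ] Matrix (m × n) (m × n) ℂ} {s a b : ℝ} (ha : 0 < a)
    (hb : 0 < b) (hE : ∀ ρ ∈ entangledDomain m n s, E ρ ∈ Set.Icc (b • 1) (a • 1)) :
    optimalLeakage E s ≤ (log (a / b) : ℝ) := by
  refine sInf_le ⟨_, fun OA OB _ _ MA MB ρ hρ ρ' hρ' T => ?_, rfl⟩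
  rw [exp_log (div_pos ha hb)]
  calc localProb MA MB (E ρ) T ≤ localProb MA MB (a • 1) T := localProb_mono MA MB T (hE ρ hρ).2
    _ = a / b * localProb MA MB (b • 1) T := by
        rw [localProb_smul, localProb_smul, ← mul_assoc, div_mul_cancel₀ a hb.ne']
    _ ≤ a / b * localProb MA MB (E ρ') T :=
        mul_le_mul_of_nonneg_left (localProb_mono MA MB T (hE ρ' hρ').1) (div_pos ha hb).le

end LocalMeasurement

section ClassicalChannel

variable {m n : Type*} [Fintype m] [Fintype n] [DecidableEq m] [DecidableEq n]

theorem productMechanism_eq_diagonal {EA : Matrix m m ℂ →ₗ[ℂ] Matrix m m ℂ}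
    {EB : Matrix n n ℂ →ₗ[ℂ] Matrix n n ℂ} {WA : Matrix m m ℂ} {WB : Matrix n n ℂ}
    (hA : ∀ X, EA X = diagonal (WA *ᵥ X.diag)) (hB : ∀ Y, EB Y = diagonal (WB *ᵥ Y.diag))
    (ρ : Matrix (m × n) (m × n) ℂ) :
    productMechanism EA EB ρ = diagonal ((WA ⊗ₖ WB) *ᵥ ρ.diag) := by
  obtain ⟨z, rfl⟩ := (kroneckerLinearEquiv m m n n ℂ).surjective ρ
  induction z using TensorProduct.induction_on with
  | zero => simp
  | tmul X Y =>
    rw [kroneckerLinearEquiv_tmul, productMechanism_kronecker, hA, hB,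
      diagonal_kronecker_diagonal]
    congr 1
    ext ⟨i, j⟩
    simp only [mulVec, dotProduct, kroneckerMap_apply, diag_apply, Fintype.sum_prod_type,
      Finset.sum_mul_sum]
    exact Finset.sum_congr rfl fun _ _ => Finset.sum_congr rfl fun _ _ => by ring
  | add x y hx hy => rw [map_add, map_add, hx, hy, diag_add, mulVec_add, diagonal_add]; rfl

theorem diagonal_ofReal_mem_Icc {m : Type*} [DecidableEq m] {a b : ℝ} {d : m → ℝ}
    (hd : ∀ i, d i ∈ Set.Icc b a) :
    diagonal (fun i => (d i : ℂ)) ∈ Set.Icc (b • (1 : Matrix m m ℂ)) (a • 1) := by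
  have hsmul (c : ℝ) : c • (1 : Matrix m m ℂ) = diagonal fun _ => (c : ℂ) := by
    ext i j
    by_cases h : i = j <;> simp [h, one_apply]
  simp only [Set.mem_Icc, le_iff, hsmul, diagonal_sub, posSemidef_diagonal_iff,
    ← Complex.ofReal_sub, Complex.zero_le_real, sub_nonneg]
  exact ⟨fun i => (hd i).1, fun i => (hd i).2⟩

end ClassicalChannel

section BlockDepolarizing

/-- The parity of a computational basis vector: `0` on the range of `evenProj`, `1` on that of
`oddProj`. -/
def parity (x : TwoQubit) : Fin 2 := x.1 + x.2

/-- The probability that the state `σ` is found to have parity `k`. -/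
noncomputable def parityProb (σ : Matrix TwoQubit TwoQubit ℂ) (k : Fin 2) : ℝ :=
  ∑ x with parity x = k, (σ x x).re

/-- The transition matrix of the classical channel on basis vectors to which `blockDepolarizing β`
reduces: with probability `1 - β` the output is uniform on the parity class of the input, and with
probability `β` it is uniform on the whole basis. -/
noncomputable def parityKernel (β : ℝ) : Matrix TwoQubit TwoQubit ℝ :=
  of fun x y => β / 4 + if parity y = parity x then (1 - β) / 2 else 0

theorem evenProj_eq_diagonal : evenProj = diagonal fun x => if parity x = 0 then 1 else 0 := by
  ext ⟨a, b⟩ ⟨c, d⟩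
  fin_cases a <;> fin_cases b <;> fin_cases c <;> fin_cases d <;> simp [evenProj, parity]

theorem oddProj_eq_diagonal : oddProj = diagonal fun x => if parity x = 1 then 1 else 0 := by
  rw [oddProj, evenProj_eq_diagonal, ← diagonal_one, diagonal_sub]
  congr 1
  ext x
  generalize parity x = k
  fin_cases k <;> simp

theorem blockDepolarizing_eq_diagonal (β : ℝ) (X : Matrix TwoQubit TwoQubit ℂ) :
    blockDepolarizing β X = diagonal ((parityKernel β).map Complex.ofReal *ᵥ X.diag) := by
  have hdef : blockDepolarizing β X = ((1 - β : ℂ) * (evenProj * X).trace / 2) • evenProj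
      + ((1 - β : ℂ) * (oddProj * X).trace / 2) • oddProj + ((β : ℂ) * X.trace / 4) • 1 := rfl
  rw [hdef, evenProj_eq_diagonal, oddProj_eq_diagonal, smul_one_eq_diagonal, ← diagonal_smul,
    ← diagonal_smul, diagonal_add, diagonal_add]
  congr 1
  ext x
  simp only [trace, diag_apply, diagonal_mul, mulVec, dotProduct, parityKernel, map_apply, of_apply,
    Pi.smul_apply, smul_eq_mul, Finset.mul_sum, Finset.sum_mul, Finset.sum_div,
    ← Finset.sum_add_distrib]
  refine Finset.sum_congr rfl fun y _ => ?_
  generalize parity x = k, parity y = l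
  fin_cases k <;> fin_cases l <;> simp <;> ring

theorem sum_parityProb (σ : Matrix TwoQubit TwoQubit ℂ) : ∑ k, parityProb σ k = σ.trace.re := by
  simp only [parityProb, Finset.sum_fiberwise, trace, Complex.re_sum, diag_apply]

theorem parityProb_one_sub {σ : Matrix TwoQubit TwoQubit ℂ} (hσ : σ.trace = 1) (k : Fin 2) :
    parityProb σ (1 - k) = 1 - parityProb σ k := by
  have h := sum_parityProb σ
  rw [hσ, Complex.one_re, Fin.sum_univ_two] at h
  revert k
  exact Fin.forall_fin_two.2 ⟨eq_sub_of_add_eq' h, eq_sub_of_add_eq h⟩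

theorem parityProb_nonneg {σ : Matrix TwoQubit TwoQubit ℂ} (hσ : σ.PosSemidef) (k : Fin 2) :
    0 ≤ parityProb σ k :=
  Finset.sum_nonneg fun _ _ => (Complex.le_def.1 hσ.diag_nonneg).1

theorem IsDensity.parityProb_le_one {σ : Matrix TwoQubit TwoQubit ℂ} (hσ : IsDensity σ)
    (k : Fin 2) : parityProb σ k ≤ 1 := by
  linarith [parityProb_one_sub hσ.2 k, parityProb_nonneg hσ.1 (1 - k)]

theorem vonNeumannEntropy_le_log_two_add_binEntropy {σ : Matrix TwoQubit TwoQubit ℂ}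
    (hσ : IsDensity σ) (k : Fin 2) :
    vonNeumannEntropy σ ≤ log 2 + binEntropy (parityProb σ k) := by
  have hcard : ∀ l, Finset.card {x | parity x = l} ≤ 2 := by decide
  have hsum : ∑ l, negMulLog (parityProb σ l) = binEntropy (parityProb σ k) := by
    rw [binEntropy_eq_negMulLog_add_negMulLog_one_sub, ← parityProb_one_sub hσ.2, Fin.sum_univ_two]
    fin_cases k <;> simp [add_comm]
  calc vonNeumannEntropy σ ≤ ∑ x, negMulLog (σ x x).re :=
        vonNeumannEntropy_le_sum_negMulLog_diag hσ.1
    _ ≤ log (2 : ℕ) + ∑ l, negMulLog (parityProb σ l) :=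
        sum_negMulLog_le_log_add_sum_fiber parity hcard hσ.re_diag_mem_stdSimplex
    _ = log 2 + binEntropy (parityProb σ k) := by rw [hsum, Nat.cast_ofNat]

theorem parityProb_le_of_le_vonNeumannEntropy {σ : Matrix TwoQubit TwoQubit ℂ} (hσ : IsDensity σ)
    {t : ℝ} (ht : t ∈ Set.Icc 2⁻¹ 1) (h : log 2 + binEntropy t ≤ vonNeumannEntropy σ)
    (k : Fin 2) : parityProb σ k ≤ t := by
  by_contra! hlt
  have := binEntropy_strictAntiOn ht ⟨ht.1.trans hlt.le, hσ.parityProb_le_one k⟩ hlt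
  linarith [vonNeumannEntropy_le_log_two_add_binEntropy hσ k]

theorem sum_filter_parity_fst (ρ : Matrix (TwoQubit × TwoQubit) (TwoQubit × TwoQubit) ℂ)
    (k : Fin 2) : ∑ w with parity w.1 = k, (ρ w w).re = parityProb (partialTraceB ρ) k := by
  simp only [parityProb, partialTraceB, of_apply, Complex.re_sum, Finset.sum_filter,
    Fintype.sum_prod_type (α₁ := TwoQubit)]
  exact Finset.sum_congr rfl fun x _ => by split_ifs <;> simp

theorem sum_filter_parity_snd (ρ : Matrix (TwoQubit × TwoQubit) (TwoQubit × TwoQubit) ℂ)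
    (l : Fin 2) : ∑ w with parity w.2 = l, (ρ w w).re = parityProb (partialTraceA ρ) l := by
  rw [partialTraceA, ← sum_filter_parity_fst, Finset.sum_filter, Finset.sum_filter]
  exact ((Equiv.prodComm TwoQubit TwoQubit).sum_comp
    fun w => if parity w.2 = l then (ρ w w).re else 0).symm

theorem parityKernel_kronecker_mulVec (βA βB : ℝ) (p : TwoQubit × TwoQubit → ℝ)
    (z : TwoQubit × TwoQubit) :
    ((parityKernel βA ⊗ₖ parityKernel βB) *ᵥ p) z =
      (βA * βB * ∑ w, p w + 2 * (1 - βA) * βB * ∑ w with parity w.1 = parity z.1, p w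
        + 2 * βA * (1 - βB) * ∑ w with parity w.2 = parity z.2, p w
        + 4 * (1 - βA) * (1 - βB) * ∑ w with parity w.1 = parity z.1 ∧ parity w.2 = parity z.2, p w)
        / 16 := by
  simp only [mulVec, dotProduct, kroneckerMap_apply, parityKernel, of_apply, Finset.sum_filter,
    Finset.mul_sum, Finset.sum_div, ← Finset.sum_add_distrib]
  refine Finset.sum_congr rfl fun w _ => ?_
  by_cases h1 : parity w.1 = parity z.1 <;> by_cases h2 : parity w.2 = parity z.2 <;>
    simp only [h1, h2, and_self, and_true, and_false, if_true, if_false] <;> ring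

variable {βA βB : ℝ}

theorem parityKernel_kronecker_mulVec_mem_Icc (hA : βA ∈ Set.Icc 0 1) (hB : βB ∈ Set.Icc 0 1)
    {ρ : Matrix (TwoQubit × TwoQubit) (TwoQubit × TwoQubit) ℂ} (hρ : IsDensity ρ) {t : ℝ}
    (htB : ∀ k, parityProb (partialTraceB ρ) k ≤ t) (htA : ∀ l, parityProb (partialTraceA ρ) l ≤ t)
    (z : TwoQubit × TwoQubit) :
    ((parityKernel βA ⊗ₖ parityKernel βB) *ᵥ fun w => (ρ w w).re) z ∈
      Set.Icc ((βA * βB + 2 * (βA + βB - 2 * βA * βB) * (1 - t)) / 16)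
        ((βA * βB + 2 * (2 - βA - βB) * t) / 16) := by
  obtain ⟨hp, hsum⟩ := hρ.re_diag_mem_stdSimplex
  have hA' := sub_nonneg.2 hA.2
  have hB' := sub_nonneg.2 hB.2
  have upperB := htB (parity z.1)
  have upperA := htA (parity z.2)
  have lowerB : 1 - t ≤ parityProb (partialTraceB ρ) (parity z.1) := by
    linarith [htB (1 - parity z.1), parityProb_one_sub hρ.partialTraceB.2 (parity z.1)]
  have lowerA : 1 - t ≤ parityProb (partialTraceA ρ) (parity z.2) := by
    linarith [htA (1 - parity z.2), parityProb_one_sub hρ.partialTraceA.2 (parity z.2)]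
  have joint_nonneg :
      0 ≤ ∑ w with parity w.1 = parity z.1 ∧ parity w.2 = parity z.2, (ρ w w).re :=
    Finset.sum_nonneg fun w _ => hp w
  have joint_le : ∑ w with parity w.1 = parity z.1 ∧ parity w.2 = parity z.2, (ρ w w).re ≤ t :=
    (Finset.sum_le_sum_of_subset_of_nonneg (Finset.monotone_filter_right _ fun _ _ h => h.1)
      fun w _ _ => hp w).trans ((sum_filter_parity_fst ρ _).trans_le upperB)
  rw [parityKernel_kronecker_mulVec, hsum, sum_filter_parity_fst, sum_filter_parity_snd]
  constructor
  · have := mul_le_mul_of_nonneg_left lowerB (mul_nonneg hA' hB.1)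
    have := mul_le_mul_of_nonneg_left lowerA (mul_nonneg hA.1 hB')
    have := mul_nonneg (mul_nonneg hA' hB') joint_nonneg
    linarith
  · have := mul_le_mul_of_nonneg_left upperB (mul_nonneg hA' hB.1)
    have := mul_le_mul_of_nonneg_left upperA (mul_nonneg hA.1 hB')
    have := mul_le_mul_of_nonneg_left joint_le (mul_nonneg hA' hB')
    linarith

theorem productMechanism_blockDepolarizing
    {ρ : Matrix (TwoQubit × TwoQubit) (TwoQubit × TwoQubit) ℂ} (hρ : ρ.IsHermitian) :
    productMechanism (blockDepolarizing βA) (blockDepolarizing βB) ρ =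
      diagonal fun z =>
        (((parityKernel βA ⊗ₖ parityKernel βB) *ᵥ fun w => (ρ w w).re) z : ℂ) := by
  rw [productMechanism_eq_diagonal (blockDepolarizing_eq_diagonal βA)
    (blockDepolarizing_eq_diagonal βB)]
  congr 1
  ext z
  simp only [mulVec, dotProduct, kroneckerMap_apply, map_apply, diag_apply, Complex.ofReal_sum,
    Complex.ofReal_mul]
  exact Finset.sum_congr rfl fun w _ => congrArg _ (hρ.coe_re_apply_self w).symm

theorem optimalLeakage_blockDepolarizing_le (hA : βA ∈ Set.Ioc 0 1) (hB : βB ∈ Set.Ioc 0 1)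
    {s t : ℝ} (ht : t ∈ Set.Icc 2⁻¹ 1)
    (hs : ∀ σ : Matrix TwoQubit TwoQubit ℂ, IsDensity σ → s ≤ vonNeumannEntropy σ →
      ∀ k, parityProb σ k ≤ t) :
    optimalLeakage (productMechanism (blockDepolarizing βA) (blockDepolarizing βB)) s ≤
      (log ((βA * βB + 2 * (2 - βA - βB) * t) /
        (βA * βB + 2 * (βA + βB - 2 * βA * βB) * (1 - t))) : ℝ) := by
  have hβ : 0 < βA * βB := mul_pos hA.1 hB.1
  have hupper : 0 < βA * βB + 2 * (2 - βA - βB) * t := by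
    have : 0 ≤ 2 - βA - βB := by linarith [hA.2, hB.2]
    have := mul_nonneg this (inv_nonneg.2 zero_le_two |>.trans ht.1)
    linarith
  have hlower : 0 < βA * βB + 2 * (βA + βB - 2 * βA * βB) * (1 - t) := by
    have : 0 ≤ βA + βB - 2 * βA * βB := by
      nlinarith [mul_nonneg hA.1.le (sub_nonneg.2 hB.2), mul_nonneg hB.1.le (sub_nonneg.2 hA.2)]
    have := mul_nonneg this (sub_nonneg.2 ht.2)
    linarith
  rw [← div_div_div_cancel_right₀ (show (16 : ℝ) ≠ 0 by norm_num)]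
  refine optimalLeakage_le_log_div (by positivity) (by positivity) fun ρ hρ => ?_
  obtain ⟨hdens, hrank, hent⟩ := hρ
  rw [productMechanism_blockDepolarizing hdens.1.isHermitian]
  refine diagonal_ofReal_mem_Icc <| parityKernel_kronecker_mulVec_mem_Icc
    (Set.Ioc_subset_Icc_self hA) (Set.Ioc_subset_Icc_self hB) hdens
    (hs _ hdens.partialTraceB hent) (hs _ hdens.partialTraceA ?_)
  rwa [vonNeumannEntropy_partialTraceA_of_rank_eq_one hdens.1 hrank]

end BlockDepolarizing

section Threshold

theorem exists_strictAntiOn_inverse {α β : Type*} [LinearOrder α] [Nonempty α] [Preorder β]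
    {f : α → β} {S : Set α} {T : Set β} (hf : StrictAntiOn f S) (hST : Set.SurjOn f S T) :
    ∃ g : β → α, StrictAntiOn g T ∧ ∀ y ∈ T, ∀ x, (x ∈ S ∧ y = f x) ↔ x = g y := by
  have hmem := hST.mapsTo_invFunOn
  have hinv := hST.rightInvOn_invFunOn
  refine ⟨Function.invFunOn f S, fun y hy y' hy' h => ?_, fun y hy x => ⟨?_, ?_⟩⟩
  · rwa [← hf.lt_iff_gt (hmem hy) (hmem hy'), hinv hy, hinv hy']
  · rintro ⟨hx, rfl⟩
    exact hf.injOn hx (hmem hy) (hinv hy).symm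
  · rintro rfl
    exact ⟨hmem hy, (hinv hy).symm⟩

theorem surjOn_log_two_add_binEntropy :
    Set.SurjOn (fun t => log 2 + binEntropy t) (Set.Icc 2⁻¹ 1) (Set.Icc (log 2) (log 4)) := by
  have hlog : log 4 = log 2 + log 2 := by
    rw [← log_mul two_ne_zero two_ne_zero]
    norm_num
  have h := intermediate_value_Icc' (show (2⁻¹ : ℝ) ≤ 1 by norm_num)
    (continuous_const.add binEntropy_continuous).continuousOn (f := fun t => log 2 + binEntropy t)
  simp only [binEntropy_one, binEntropy_two_inv, add_zero, ← hlog] at h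
  exact h

theorem strictAntiOn_log_two_add_binEntropy :
    StrictAntiOn (fun t => log 2 + binEntropy t) (Set.Icc 2⁻¹ 1) :=
  fun _ hx _ hy h => add_lt_add_right (binEntropy_strictAntiOn hx hy h) _

theorem log_two_add_binEntropy (t : ℝ) :
    log 2 + binEntropy t = log 2 - t * log t - (1 - t) * log (1 - t) := by
  rw [binEntropy_eq_negMulLog_add_negMulLog_one_sub, negMulLog, negMulLog]
  ring

theorem log_leakage_ratio_half_le {t : ℝ} (ht : t ∈ Set.Icc (1 / 2) 1) :
    log ((1 / 2 * (1 / 2) + 2 * (2 - 1 / 2 - 1 / 2) * t) /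
      (1 / 2 * (1 / 2) + 2 * (1 / 2 + 1 / 2 - 2 * (1 / 2) * (1 / 2)) * (1 - t))) ≤
      log ((8 * t + 1) / (3 - 2 * t)) := by
  obtain ⟨hhalf, hone⟩ := ht
  have hnum : 0 < 8 * t + 1 := by linarith
  have hratio : (1 / 2 * (1 / 2) + 2 * (2 - 1 / 2 - 1 / 2) * t) /
      (1 / 2 * (1 / 2) + 2 * (1 / 2 + 1 / 2 - 2 * (1 / 2) * (1 / 2)) * (1 - t)) =
      (8 * t + 1) / (5 - 4 * t) := by
    rw [← mul_div_mul_left _ _ (four_ne_zero (α := ℝ))]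
    ring_nf
  rw [hratio]
  exact log_le_log (div_pos hnum (by linarith))
    (div_le_div_of_nonneg_left hnum.le (by linarith) (by linarith))

end Threshold

end QLDP

open QLDP Real in
theorem mainTheorem6_general {βA βB : ℝ} (hA : βA ∈ Set.Ioc 0 1) (hB : βB ∈ Set.Ioc 0 1) :
    (∀ s : ℝ,
      optimalLeakage (productMechanism (blockDepolarizing βA) (blockDepolarizing βB)) s ≤
        (log ((2 - βA) * (2 - βB) / (βA * βB)) : ℝ)) ∧
    ∃ τ : ℝ → ℝ,
      StrictAntiOn τ (Set.Icc (log 2) (log 4)) ∧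
      ∀ s ∈ Set.Icc (log 2) (log 4),
        (∀ t : ℝ, (t ∈ Set.Icc (1 / 2) 1 ∧ s = log 2 - t * log t - (1 - t) * log (1 - t)) ↔
          t = τ s) ∧
        optimalLeakage (productMechanism (blockDepolarizing βA) (blockDepolarizing βB)) s ≤
          (log ((βA * βB + 2 * (2 - βA - βB) * τ s) /
            (βA * βB + 2 * (βA + βB - 2 * βA * βB) * (1 - τ s))) : ℝ) := by
  simp only [one_div, ← log_two_add_binEntropy]
  constructor
  · intro s
    convert optimalLeakage_blockDepolarizing_le hA hB (s := s) (t := 1) (by norm_num)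
      fun σ hσ _ => hσ.parityProb_le_one using 4 <;> ring
  · obtain ⟨τ, hanti, hτ⟩ := exists_strictAntiOn_inverse strictAntiOn_log_two_add_binEntropy
      surjOn_log_two_add_binEntropy
    refine ⟨τ, hanti, fun s hs => ⟨hτ s hs, ?_⟩⟩
    obtain ⟨hmem, heq⟩ := (hτ s hs (τ s)).2 rfl
    exact optimalLeakage_blockDepolarizing_le hA hB hmem fun σ hσ hent =>
      parityProb_le_of_le_vonNeumannEntropy hσ hmem (heq ▸ hent)

theorem mainTheorem6 :
    (∀ s : ℝ, s ≤ Real.log 2 →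
      QLDP.optimalLeakage
          (QLDP.productMechanism (QLDP.blockDepolarizing (1 / 2)) (QLDP.blockDepolarizing (1 / 2))) s
        ≤ ((2 * Real.log 3 : ℝ) : EReal)) ∧
    ∃ τ : ℝ → ℝ,
      StrictAntiOn τ (Set.Ioc (Real.log 2) (Real.log 4)) ∧
      ∀ s ∈ Set.Ioc (Real.log 2) (Real.log 4),
        (∀ t : ℝ,
          (t ∈ Set.Icc (1 / 2 : ℝ) 1 ∧
            s = Real.log 2 - t * Real.log t - (1 - t) * Real.log (1 - t)) ↔ t = τ s) ∧
        QLDP.optimalLeakage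
            (QLDP.productMechanism (QLDP.blockDepolarizing (1 / 2))
              (QLDP.blockDepolarizing (1 / 2))) s
          ≤ ((Real.log ((8 * τ s + 1) / (3 - 2 * τ s)) : ℝ) : EReal) := by
  have hhalf : (1 / 2 : ℝ) ∈ Set.Ioc 0 1 := by norm_num
  obtain ⟨hall, τ, hanti, hτ⟩ := mainTheorem6_general hhalf hhalf
  refine ⟨fun s _ => (hall s).trans_eq ?_, τ, hanti.mono Set.Ioc_subset_Icc_self, fun s hs => ?_⟩
  · rw [← Real.log_rpow (by norm_num)]
    norm_num
  · obtain ⟨hiff, hle⟩ := hτ s (Set.Ioc_subset_Icc_self hs)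
    exact ⟨hiff, hle.trans (EReal.coe_le_coe (QLDP.log_leakage_ratio_half_le ((hiff _).2 rfl).1))⟩
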